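/- Let $n$ be a positive integer. Write permutations of $\{1,\dots,n\}$ in one-line notation $p=p_1p_2\cdots p_n$. A descent of $p$ is a position $i$ with $1\le i\le n-1$ and $p_i>p_{i+1}$. For $k\ge 0$ let $A(n,k)$ be the number of permutations of $\{1,\dots,n\}$ with exactly $k$ descents. Call $p$ half-ascending if $p_{2i-1}<p_{2i}$ for all integers $i$ with $1\le i\le n/2$, and let $U(n,k)$ be the number of half-ascending permutations of $\{1,\dots,n\}$ with exactly $k$ descents. Then for all positive integers $n$ and all positive integers $k\le n$, \[A(n,k-1)\,A(n,k+1)\le A(n,k)^2\qquad\text{and}\qquad U(n,k-1)\,U(n,k+1)\le U(n,k)^2 .\] -/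

import Mathlib

/-- The descents of the permutation `p = p₁ p₂ ⋯ pₙ` (one-line notation, positions and values
indexed from `0`): the positions `i` that are not last and satisfy `p i > p (i + 1)`. -/
def descents {n : ℕ} (p : Equiv.Perm (Fin n)) : Finset (Fin n) :=
  Finset.univ.filter fun i => ∃ h : i.val + 1 < n, p ⟨i.val + 1, h⟩ < p i

/-- `p` is half-ascending: `p_{2i-1} < p_{2i}` for all `1 ≤ i ≤ n/2` (positions counted from `1`).
Counted from `0`, with `i` running over `0, …, ⌊n/2⌋ - 1`, this reads `p (2i) < p (2i+1)`. -/
def HalfAscending {n : ℕ} (p : Equiv.Perm (Fin n)) : Prop :=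
  ∀ i : Fin (n / 2), p ⟨2 * i.val, by omega⟩ < p ⟨2 * i.val + 1, by omega⟩

instance {n : ℕ} : DecidablePred (HalfAscending (n := n)) := fun p =>
  inferInstanceAs (Decidable
    (∀ i : Fin (n / 2), p ⟨2 * i.val, by omega⟩ < p ⟨2 * i.val + 1, by omega⟩))

/-- The Eulerian number `A(n,k)`: the number of `n`-permutations with exactly `k` descents. -/
def eulerianA (n k : ℕ) : ℕ :=
  (Finset.univ.filter fun p : Equiv.Perm (Fin n) => (descents p).card = k).card

/-- `U(n,k)`: the number of half-ascending `n`-permutations with exactly `k` descents. -/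
def halfAscU (n k : ℕ) : ℕ :=
  (Finset.univ.filter fun p : Equiv.Perm (Fin n) =>
    HalfAscending p ∧ (descents p).card = k).card

/-! Half-ascending means that descents occur only at odd positions (counted from `0`), so both
inequalities are cases of one: log-concavity of descent counts over permutations with all descents
in a fixed set `S`. Refine the counts by last entry. Appending a last entry `j` creates a descent
exactly when the previous last entry `i` satisfies `j ≤ i`. If descents are allowed there, the new
sequence for `j` sums `N` consecutive terms of `D (N - 1), …, D 0, t D (N - 1), …`, and as `j`
decreases this window slides to the right; otherwise only the terms with `i < j` remain. Sliding
preserves the likelihood ratio order (`append_any`, `append_ascent`), and comparing the total with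
its own shift is log-concavity. -/

open Finset

/-! ### Likelihood ratio order on sequences -/

/-- The likelihood ratio order on sequences indexed by `ℤ`. -/
def LikelihoodRatioLE (f g : ℤ → ℕ) : Prop :=
  ∀ k l, k < l → f l * g k ≤ f k * g l

namespace LikelihoodRatioLE

/-- The defining inequality is linear in each argument, so sums compare termwise. Zeros spoil
transitivity, hence every pair has to be compared directly. -/
theorem add_left {f f' g : ℤ → ℕ} (h : LikelihoodRatioLE f g) (h' : LikelihoodRatioLE f' g) :
    LikelihoodRatioLE (f + f') g := fun k l hkl => by
  have := h k l hkl
  have := h' k l hkl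
  simp only [Pi.add_apply, add_mul]
  omega

theorem add_right {f g g' : ℤ → ℕ} (h : LikelihoodRatioLE f g) (h' : LikelihoodRatioLE f g') :
    LikelihoodRatioLE f (g + g') := fun k l hkl => by
  have := h k l hkl
  have := h' k l hkl
  simp only [Pi.add_apply, mul_add]
  omega

theorem sum_sum {ι κ : Type*} {f : ι → ℤ → ℕ} {g : κ → ℤ → ℕ} {s : Finset ι} {t : Finset κ}
    (h : ∀ i ∈ s, ∀ j ∈ t, LikelihoodRatioLE (f i) (g j)) :
    LikelihoodRatioLE (∑ i ∈ s, f i) (∑ j ∈ t, g j) := fun k l hkl => by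
  simp only [Finset.sum_apply, Finset.sum_mul_sum]
  exact Finset.sum_le_sum fun i hi => Finset.sum_le_sum fun j hj => h i hi j hj k l hkl

theorem refl (f : ℤ → ℕ) : LikelihoodRatioLE f f := fun k l _ => by rw [mul_comm]

/-- Sums with a common part `c` compare as soon as their other parts do. -/
theorem add_common {a b c : ℤ → ℕ} (hac : LikelihoodRatioLE a c) (hab : LikelihoodRatioLE a b)
    (hcb : LikelihoodRatioLE c b) : LikelihoodRatioLE (a + c) (b + c) :=
  add_left (hab.add_right hac) (hcb.add_right (refl c))

end LikelihoodRatioLE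

/-! ### Cyclically ordered families and sliding windows -/

/-- A family `D 0, …, D (N - 1)` such that the sequence
`D (N - 1), …, D 0, t D (N - 1), …, t D 0, t² D (N - 1), …` increases in the likelihood ratio
order, where `t` shifts a sequence by one. -/
structure CyclicallyOrdered (N : ℕ) (D : ℕ → ℤ → ℕ) : Prop where
  anti : ∀ i j, i ≤ j → j < N → LikelihoodRatioLE (D j) (D i)
  shift : ∀ i j, i < N → j < N → ∀ a b : ℤ, a < b →
    LikelihoodRatioLE (fun k => D i (k - a)) (fun k => D j (k - b))

namespace CyclicallyOrdered

variable {N : ℕ} {D : ℕ → ℤ → ℕ}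

/-- The sum of the members of the family with indices in `s`, shifted by `a`. -/
def blockSum (D : ℕ → ℤ → ℕ) (a : ℤ) (s : Finset ℕ) : ℤ → ℕ :=
  ∑ i ∈ s, fun k => D i (k - a)

theorem blockSum_apply (a : ℤ) (s : Finset ℕ) (k : ℤ) :
    blockSum D a s k = ∑ i ∈ s, D i (k - a) := by
  simp [blockSum, Finset.sum_apply]

theorem anti_shift (h : CyclicallyOrdered N D) {i j : ℕ} (hij : i ≤ j) (hj : j < N) (a : ℤ) :
    LikelihoodRatioLE (fun k => D j (k - a)) (fun k => D i (k - a)) :=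
  fun k l hkl => h.anti i j hij hj (k - a) (l - a) (by omega)

theorem blockSum_lt (h : CyclicallyOrdered N D) {a b : ℤ} (hab : a < b) {s t : Finset ℕ}
    (hs : ∀ i ∈ s, i < N) (ht : ∀ i ∈ t, i < N) :
    LikelihoodRatioLE (blockSum D a s) (blockSum D b t) :=
  .sum_sum fun i hi j hj => h.shift i j (hs i hi) (ht j hj) a b hab

theorem blockSum_eq (h : CyclicallyOrdered N D) (a : ℤ) {s t : Finset ℕ}
    (hs : ∀ i ∈ s, i < N) (hst : ∀ i ∈ s, ∀ j ∈ t, j ≤ i) :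
    LikelihoodRatioLE (blockSum D a s) (blockSum D a t) :=
  .sum_sum fun i hi j hj => h.anti_shift (hst i hi j hj) (hs i hi) a

theorem blockSum_range_split {i j : ℕ} (hij : i ≤ j) (a : ℤ) :
    blockSum D a (range j) = blockSum D a (range i) + blockSum D a (Ico i j) :=
  (Finset.sum_range_add_sum_Ico _ hij).symm

theorem blockSum_Ico_split {i j : ℕ} (hij : i ≤ j) (hj : j ≤ N) (a : ℤ) :
    blockSum D a (Ico i N) = blockSum D a (Ico i j) + blockSum D a (Ico j N) :=
  (Finset.sum_Ico_consecutive _ hij hj).symm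

/-- Appending an ascent. -/
theorem append_ascent (h : CyclicallyOrdered N D) {D' : ℕ → ℤ → ℕ}
    (hD' : ∀ j ≤ N, ∀ k, D' j k = ∑ i ∈ range j, D i k) : CyclicallyOrdered (N + 1) D' := by
  have key : ∀ j ≤ N, ∀ a : ℤ, (fun k => D' j (k - a)) = blockSum D a (range j) := by
    intro j hj a
    funext k
    rw [blockSum_apply, hD' j hj]
  constructor
  · intro i j hij hj
    have e0 : ∀ j, D' j = fun k => D' j (k - 0) := fun j => by simp
    rw [e0 i, e0 j, key i (by omega), key j (by omega), blockSum_range_split hij]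
    refine .add_left (.refl _) (h.blockSum_eq 0 ?_ ?_) <;> simp <;> omega
  · intro i j hi hj a b hab
    rw [key i (by omega), key j (by omega)]
    refine h.blockSum_lt hab ?_ ?_ <;> simp <;> omega

/-- Appending either an ascent or a descent. -/
theorem append_any (h : CyclicallyOrdered N D) {D' : ℕ → ℤ → ℕ}
    (hD' : ∀ j ≤ N, ∀ k, D' j k = ∑ i ∈ range j, D i k + ∑ i ∈ Ico j N, D i (k - 1)) :
    CyclicallyOrdered (N + 1) D' := by
  have key : ∀ j ≤ N, ∀ a : ℤ, (fun k => D' j (k - a)) =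
      blockSum D a (range j) + blockSum D (a + 1) (Ico j N) := by
    intro j hj a
    funext k
    rw [Pi.add_apply, blockSum_apply, blockSum_apply, hD' j hj]
    simp only [sub_sub]
  constructor
  · intro i j hij hj
    have e0 : ∀ j, D' j = fun k => D' j (k - 0) := fun j => by simp
    rw [e0 i, e0 j, key i (by omega), key j (by omega), blockSum_range_split hij,
      blockSum_Ico_split (N := N) hij (by omega)]
    set x := blockSum D 0 (range i)
    set y := blockSum D 0 (Ico i j)
    set z := blockSum D (0 + 1) (Ico i j)
    set w := blockSum D (0 + 1) (Ico j N)
    -- The two windows share `x + w`; they differ by `y` against its shift `z`.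
    rw [show x + y + w = y + (x + w) by abel, show x + (z + w) = z + (x + w) by abel]
    refine .add_common (.add_right ?_ ?_) ?_ (.add_left ?_ ?_)
    · refine h.blockSum_eq _ ?_ ?_ <;> simp <;> omega
    · refine h.blockSum_lt (by omega) ?_ ?_ <;> (simp; try omega)
    · refine h.blockSum_lt (by omega) ?_ ?_ <;> simp <;> omega
    · refine h.blockSum_lt (by omega) ?_ ?_ <;> simp <;> omega
    · refine h.blockSum_eq _ ?_ ?_ <;> (simp; try omega)
  · intro i j hi hj a b hab
    rw [key i (by omega), key j (by omega)]
    have lt : ∀ {a b : ℤ} {s t : Finset ℕ}, a < b → s ⊆ range N → t ⊆ range N →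
        LikelihoodRatioLE (blockSum D a s) (blockSum D b t) := fun hab hs ht =>
      h.blockSum_lt hab (fun i hi => by simpa using hs hi) (fun i hi => by simpa using ht hi)
    have hr : ∀ i ≤ N, range i ⊆ range N := fun i hi => range_subset_range.2 hi
    have hI : ∀ i j, j ≤ N → Ico i j ⊆ range N := fun i j hj x hx => by
      simp at hx ⊢; omega
    have hi' := hr i (by omega)
    have hj' := hr j (by omega)
    -- The windows reach up to shifts `a + 1` and `b + 1`, so they can overlap only if `b = a + 1`,
    -- and then exactly in the indices from `i` to `j - 1`.
    obtain hab' | rfl : a + 1 < b ∨ a + 1 = b := by omega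
    · refine .add_left (.add_right ?_ ?_) (.add_right ?_ ?_) <;>
        exact lt (by omega) (by first | assumption | exact hI _ _ le_rfl)
          (by first | assumption | exact hI _ _ le_rfl)
    · rcases le_or_gt j i with hji | hij
      · refine .add_left (.add_right ?_ ?_) (.add_right ?_ ?_)
        · exact lt (by omega) hi' hj'
        · exact lt (by omega) hi' (hI _ _ le_rfl)
        · refine h.blockSum_eq _ ?_ ?_ <;> (simp; try omega)
        · exact lt (by omega) (hI _ _ le_rfl) (hI _ _ le_rfl)
      · rw [blockSum_Ico_split (N := N) hij.le (by omega), blockSum_range_split hij.le]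
        set x := blockSum D a (range i)
        set y := blockSum D (a + 1) (Ico i j)
        set z := blockSum D (a + 1) (Ico j N)
        set u := blockSum D (a + 1) (range i)
        set v := blockSum D (a + 1 + 1) (Ico j N)
        have hIj := hI i j (by omega)
        rw [show x + (y + z) = (x + z) + y by abel, show u + y + v = (u + v) + y by abel]
        refine .add_common (.add_left ?_ ?_) (.add_left (.add_right ?_ ?_) (.add_right ?_ ?_))
          (.add_right ?_ ?_)
        · exact lt (by omega) hi' hIj
        · refine h.blockSum_eq _ ?_ ?_ <;> (simp; try omega)
        · exact lt (by omega) hi' hi'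
        · exact lt (by omega) hi' (hI _ _ le_rfl)
        · refine h.blockSum_eq _ ?_ ?_ <;> (simp; try omega)
        · exact lt (by omega) (hI _ _ le_rfl) (hI _ _ le_rfl)
        · refine h.blockSum_eq _ ?_ ?_ <;> simp <;> omega
        · exact lt (by omega) hIj (hI _ _ le_rfl)

theorem sum_logConcave (h : CyclicallyOrdered N D) (k : ℤ) :
    (∑ i ∈ range N, D i (k - 1)) * (∑ i ∈ range N, D i (k + 1)) ≤
      (∑ i ∈ range N, D i k) ^ 2 := by
  -- The total against its shift by one, evaluated at `k < k + 1`.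
  have := h.blockSum_lt (a := 0) (b := 1) (s := range N) (t := range N) (by omega)
    (by simp) (by simp) k (k + 1) (by omega)
  simp only [blockSum_apply, sub_zero, add_sub_cancel_right] at this
  rw [mul_comm, sq]
  exact this

end CyclicallyOrdered

/-! ### Permutations by last entry -/

/-- The permutation whose last entry is `j` and whose other entries are ordered as in `q`. -/
def appendLast {n : ℕ} (j : Fin (n + 1)) (q : Equiv.Perm (Fin n)) : Equiv.Perm (Fin (n + 1)) :=
  ((finSuccEquiv' (Fin.last n)).trans q.optionCongr).trans (finSuccEquiv' j).symm

@[simp]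
theorem appendLast_last {n : ℕ} (j : Fin (n + 1)) (q : Equiv.Perm (Fin n)) :
    appendLast j q (Fin.last n) = j := by
  simp [appendLast]

@[simp]
theorem appendLast_castSucc {n : ℕ} (j : Fin (n + 1)) (q : Equiv.Perm (Fin n)) (i : Fin n) :
    appendLast j q i.castSucc = j.succAbove (q i) := by
  have := finSuccEquiv'_succAbove (Fin.last n) i
  rw [Fin.succAbove_last] at this
  simp [appendLast, this]

theorem appendLast_bijective (n : ℕ) :
    Function.Bijective fun x : Fin (n + 1) × Equiv.Perm (Fin n) => appendLast x.1 x.2 := by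
  rw [Fintype.bijective_iff_injective_and_card]
  constructor
  · rintro ⟨j, q⟩ ⟨j', q'⟩ h
    simp only at h
    have hj : j = j' := by
      rw [← appendLast_last j q, h, appendLast_last]
    subst hj
    have hq : q = q' := by
      ext i : 1
      apply Fin.succAbove_right_injective (p := j)
      rw [← appendLast_castSucc, h, appendLast_castSucc]
    rw [hq]
  · simp [Fintype.card_perm, Nat.factorial_succ]

theorem mem_descents {n : ℕ} {p : Equiv.Perm (Fin n)} {i : Fin n} :
    i ∈ descents p ↔ ∃ h : i.val + 1 < n, p ⟨i.val + 1, h⟩ < p i := by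
  simp [descents]

theorem last_notMem_descents {n : ℕ} (p : Equiv.Perm (Fin (n + 1))) :
    Fin.last n ∉ descents p := by
  simp [mem_descents]

/-- `j.succAbove` is strictly increasing, so old comparisons survive and only the junction with the
new entry is new. -/
theorem castSucc_mem_descents_appendLast {n : ℕ} (j : Fin (n + 2)) (q : Equiv.Perm (Fin (n + 1)))
    (i : Fin (n + 1)) :
    i.castSucc ∈ descents (appendLast j q) ↔
      i ∈ descents q ∨ (i = Fin.last n ∧ j ≤ (q i).castSucc) := by
  refine Fin.lastCases ?_ (fun i => ?_) i
  · have e : (⟨(Fin.last n).castSucc.val + 1, by simp⟩ : Fin (n + 2)) = Fin.last (n + 1) := by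
      ext; simp
    simp only [true_and, mem_descents, e, appendLast_last, appendLast_castSucc]
    rw [Fin.lt_succAbove_iff_le_castSucc]
    simp
  · have e : (⟨i.castSucc.castSucc.val + 1, by simp⟩ : Fin (n + 2)) =
      (i.succ).castSucc := by ext; simp
    have e' : (⟨i.castSucc.val + 1, by simp⟩ : Fin (n + 1)) = i.succ := by ext; simp
    have hne : i.castSucc ≠ Fin.last n := (Fin.castSucc_lt_last i).ne
    simp only [mem_descents, hne, false_and, or_false, e, e', appendLast_castSucc,
      (Fin.strictMono_succAbove j).lt_iff_lt]
    simp

theorem descents_appendLast_of_lt {n : ℕ} {j : Fin (n + 2)} {q : Equiv.Perm (Fin (n + 1))}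
    (h : (q (Fin.last n)).castSucc < j) :
    descents (appendLast j q) = (descents q).map Fin.castSuccEmb := by
  ext i
  refine Fin.lastCases ?_ (fun i => ?_) i
  · simp [last_notMem_descents, (Fin.castSucc_lt_last _).ne]
  · rw [castSucc_mem_descents_appendLast]
    have : ¬ (i = Fin.last n ∧ j ≤ (q i).castSucc) := by
      rintro ⟨rfl, h'⟩; exact absurd h (not_lt.2 h')
    simp [this]

theorem descents_appendLast_of_le {n : ℕ} {j : Fin (n + 2)} {q : Equiv.Perm (Fin (n + 1))}
    (h : j ≤ (q (Fin.last n)).castSucc) :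
    descents (appendLast j q) =
      ((descents q).cons (Fin.last n) (last_notMem_descents q)).map Fin.castSuccEmb := by
  ext i
  refine Fin.lastCases ?_ (fun i => ?_) i
  · simp [last_notMem_descents, (Fin.castSucc_lt_last _).ne, (Fin.castSucc_lt_last _).ne']
  · rw [castSucc_mem_descents_appendLast]
    simp only [mem_map, mem_cons, Fin.coe_castSuccEmb, Fin.castSucc_inj, exists_eq_right]
    constructor
    · rintro (h' | ⟨rfl, -⟩) <;> simp [*]
    · rintro (rfl | h') <;> simp [*]

/-! ### Log-concavity for prescribed descent positions -/

/-- The number of permutations of `Fin (n + 1)` with last entry `j`, all of whose descents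
lie in `S`, and with exactly `k` descents. -/
noncomputable def lastEntryCount (S : Set ℕ) (n j : ℕ) (k : ℤ) : ℕ :=
  Nat.card {p : Equiv.Perm (Fin (n + 1)) //
    (p (Fin.last n)).val = j ∧ (∀ i ∈ descents p, i.val ∈ S) ∧ ((descents p).card : ℤ) = k}

theorem card_eq_sum_card_fiber {α : Type*} [Fintype α] (P : α → Prop) (f : α → ℕ) (N : ℕ)
    (hf : ∀ x, P x → f x < N) :
    Nat.card {x // P x} = ∑ i ∈ range N, Nat.card {x // f x = i ∧ P x} := by
  classical
  simp only [Nat.card_eq_fintype_card, Fintype.card_subtype]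
  rw [Finset.card_eq_sum_card_fiberwise (f := f) (t := range N)
    (fun x hx => by simpa using hf x (by simpa using hx))]
  simp only [Finset.filter_filter, and_comm]

/-- Deleting the last entry `j` is a bijection. The result is sorted by its own last entry `i`,
which alone decides whether the junction is a descent. -/
theorem lastEntryCount_succ_eq_sum (S : Set ℕ) (n j : ℕ) (hj : j ≤ n + 1) (k : ℤ) :
    lastEntryCount S (n + 1) j k = ∑ i ∈ range (n + 1),
      Nat.card {q : Equiv.Perm (Fin (n + 1)) // (q (Fin.last n)).val = i ∧
        (∀ i ∈ descents (appendLast ⟨j, by omega⟩ q), i.val ∈ S) ∧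
        ((descents (appendLast ⟨j, by omega⟩ q)).card : ℤ) = k} := by
  rw [← card_eq_sum_card_fiber _ (fun q : Equiv.Perm (Fin (n + 1)) => (q (Fin.last n)).val)
    (n + 1) (fun q _ => (q (Fin.last n)).isLt)]
  symm
  refine Nat.card_eq_of_bijective
    (fun q => ⟨appendLast ⟨j, by omega⟩ q.1, by simp, q.2⟩) ⟨?_, ?_⟩
  · rintro ⟨q, hq⟩ ⟨q', hq'⟩ h
    have := (appendLast_bijective (n + 1)).1 (a₁ := (⟨j, by omega⟩, q))
      (a₂ := (⟨j, by omega⟩, q')) (congrArg Subtype.val h)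
    simpa using this
  · rintro ⟨p, hp, hp'⟩
    obtain ⟨⟨j', q⟩, rfl⟩ := (appendLast_bijective (n + 1)).2 p
    have hj' : j' = ⟨j, by omega⟩ := by
      ext; simpa using hp
    exact ⟨⟨q, hj' ▸ hp'⟩, by simp [hj']⟩

theorem lastEntryCount_summand_of_lt (S : Set ℕ) {n i j : ℕ} (hj : j ≤ n + 1) (hij : i < j)
    (k : ℤ) :
    Nat.card {q : Equiv.Perm (Fin (n + 1)) // (q (Fin.last n)).val = i ∧
        (∀ i ∈ descents (appendLast ⟨j, by omega⟩ q), i.val ∈ S) ∧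
        ((descents (appendLast ⟨j, by omega⟩ q)).card : ℤ) = k} = lastEntryCount S n i k := by
  refine Nat.card_congr (Equiv.subtypeEquivRight fun q => and_congr_right fun hq => ?_)
  rw [descents_appendLast_of_lt (by rw [Fin.lt_def]; simpa [hq] using hij)]
  simp

theorem lastEntryCount_summand_of_le (S : Set ℕ) {n i j : ℕ} (hj : j ≤ n + 1) (hij : j ≤ i)
    (hn : n ∈ S) (k : ℤ) :
    Nat.card {q : Equiv.Perm (Fin (n + 1)) // (q (Fin.last n)).val = i ∧
        (∀ i ∈ descents (appendLast ⟨j, by omega⟩ q), i.val ∈ S) ∧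
        ((descents (appendLast ⟨j, by omega⟩ q)).card : ℤ) = k} =
      lastEntryCount S n i (k - 1) := by
  refine Nat.card_congr (Equiv.subtypeEquivRight fun q => and_congr_right fun hq => ?_)
  rw [descents_appendLast_of_le (by rw [Fin.le_def]; simpa [hq] using hij)]
  rw [Finset.card_map, Finset.card_cons, eq_sub_iff_add_eq, Nat.cast_add, Nat.cast_one]
  simp [hn]

theorem lastEntryCount_summand_of_notMem (S : Set ℕ) {n i j : ℕ} (hj : j ≤ n + 1) (hij : j ≤ i)
    (hn : n ∉ S) (k : ℤ) :
    Nat.card {q : Equiv.Perm (Fin (n + 1)) // (q (Fin.last n)).val = i ∧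
        (∀ i ∈ descents (appendLast ⟨j, by omega⟩ q), i.val ∈ S) ∧
        ((descents (appendLast ⟨j, by omega⟩ q)).card : ℤ) = k} = 0 := by
  rw [Nat.card_eq_zero]
  left
  refine ⟨fun ⟨q, hq, hS, _⟩ => hn ?_⟩
  rw [descents_appendLast_of_le (by rw [Fin.le_def]; simpa [hq] using hij)] at hS
  simpa using hS (Fin.last n).castSucc (by simp)

theorem lastEntryCount_succ_of_mem (S : Set ℕ) {n j : ℕ} (hj : j ≤ n + 1) (hn : n ∈ S) (k : ℤ) :
    lastEntryCount S (n + 1) j k = ∑ i ∈ range j, lastEntryCount S n i k +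
      ∑ i ∈ Ico j (n + 1), lastEntryCount S n i (k - 1) := by
  rw [lastEntryCount_succ_eq_sum S n j hj, ← Finset.sum_range_add_sum_Ico _ hj]
  congr 1
  · exact Finset.sum_congr rfl fun i hi =>
      lastEntryCount_summand_of_lt S hj (Finset.mem_range.1 hi) k
  · exact Finset.sum_congr rfl fun i hi =>
      lastEntryCount_summand_of_le S hj (Finset.mem_Ico.1 hi).1 hn k

theorem lastEntryCount_succ_of_notMem (S : Set ℕ) {n j : ℕ} (hj : j ≤ n + 1) (hn : n ∉ S)
    (k : ℤ) :
    lastEntryCount S (n + 1) j k = ∑ i ∈ range j, lastEntryCount S n i k := by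
  rw [lastEntryCount_succ_eq_sum S n j hj, ← Finset.sum_range_add_sum_Ico _ hj,
    Finset.sum_eq_zero (s := Ico j (n + 1)), add_zero]
  · exact Finset.sum_congr rfl fun i hi =>
      lastEntryCount_summand_of_lt S hj (Finset.mem_range.1 hi) k
  · exact fun i hi =>
      lastEntryCount_summand_of_notMem S hj (Finset.mem_Ico.1 hi).1 hn k

theorem lastEntryCount_zero_of_ne (S : Set ℕ) (j : ℕ) {k : ℤ} (hk : k ≠ 0) :
    lastEntryCount S 0 j k = 0 := by
  rw [lastEntryCount, Nat.card_eq_zero]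
  left
  refine ⟨fun ⟨p, _, _, hp⟩ => hk ?_⟩
  have : descents p = ∅ :=
    Finset.eq_empty_of_forall_notMem fun i hi => by
      obtain ⟨h, -⟩ := mem_descents.1 hi
      omega
  simpa [this] using hp.symm

theorem cyclicallyOrdered_lastEntryCount (S : Set ℕ) (n : ℕ) :
    CyclicallyOrdered (n + 1) (lastEntryCount S n) := by
  induction n with
  | zero =>
    constructor
    · intro i j hij hj
      obtain rfl : i = j := by omega
      exact .refl _
    · intro i j _ _ a b hab k l hkl
      -- Both sequences live at `0`, and `k - b < l - a`, so one factor on the left vanishes.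
      by_cases hl : l - a = 0
      · have : k - b ≠ 0 := by omega
        simp [lastEntryCount_zero_of_ne S j this]
      · simp [lastEntryCount_zero_of_ne S i hl]
  | succ n ih =>
    -- `n` is the position of the junction.
    by_cases hn : n ∈ S
    · exact ih.append_any fun j hj k => lastEntryCount_succ_of_mem S hj hn k
    · exact ih.append_ascent fun j hj k => lastEntryCount_succ_of_notMem S hj hn k

/-- For any set `S` of positions, the numbers of permutations with all descents in `S`, counted
by their number of descents, form a log-concave sequence. -/
theorem card_descents_in_logConcave (S : Set ℕ) (n : ℕ) (k : ℤ) :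
    Nat.card {p : Equiv.Perm (Fin (n + 1)) //
        (∀ i ∈ descents p, i.val ∈ S) ∧ ((descents p).card : ℤ) = k - 1} *
      Nat.card {p : Equiv.Perm (Fin (n + 1)) //
        (∀ i ∈ descents p, i.val ∈ S) ∧ ((descents p).card : ℤ) = k + 1} ≤
    Nat.card {p : Equiv.Perm (Fin (n + 1)) //
        (∀ i ∈ descents p, i.val ∈ S) ∧ ((descents p).card : ℤ) = k} ^ 2 := by
  have key : ∀ k : ℤ, Nat.card {p : Equiv.Perm (Fin (n + 1)) //
      (∀ i ∈ descents p, i.val ∈ S) ∧ ((descents p).card : ℤ) = k} =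
      ∑ j ∈ range (n + 1), lastEntryCount S n j k := fun k =>
    card_eq_sum_card_fiber _ (fun p : Equiv.Perm (Fin (n + 1)) => (p (Fin.last n)).val) (n + 1)
      fun p _ => (p (Fin.last n)).isLt
  simp only [key]
  exact (cyclicallyOrdered_lastEntryCount S n).sum_logConcave k

/-! ### Specialization to all positions and to odd positions -/

theorem halfAscending_iff {n : ℕ} (p : Equiv.Perm (Fin n)) :
    HalfAscending p ↔ ∀ i ∈ descents p, i.val ∈ {m : ℕ | Odd m} := by
  constructor
  · intro h i hi
    by_contra hodd
    obtain ⟨m, hm⟩ := Nat.not_odd_iff_even.1 hodd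
    obtain ⟨hlt, hp⟩ := mem_descents.1 hi
    have := h ⟨m, by omega⟩
    have e : (⟨2 * m, by omega⟩ : Fin n) = i := by ext; simp; omega
    have e' : (⟨2 * m + 1, by omega⟩ : Fin n) = ⟨i.val + 1, hlt⟩ := by ext; simp; omega
    simp only [e, e'] at this
    exact lt_asymm hp this
  · intro h i
    by_contra hlt
    have hne : p ⟨2 * i.val, by omega⟩ ≠ p ⟨2 * i.val + 1, by omega⟩ := by
      intro he
      simpa using p.injective he
    have hmem : (⟨2 * i.val, by omega⟩ : Fin n) ∈ descents p :=
      mem_descents.2 ⟨by simp only; omega, lt_of_le_of_ne (not_lt.1 hlt) hne.symm⟩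
    have hodd := h _ hmem
    simp only [Set.mem_ofPred_eq, Nat.odd_iff] at hodd
    omega

theorem eulerianA_eq (n k : ℕ) :
    eulerianA n k = Nat.card {p : Equiv.Perm (Fin n) //
      (∀ i ∈ descents p, i.val ∈ Set.univ) ∧ ((descents p).card : ℤ) = k} := by
  classical
  simp only [eulerianA, Nat.card_eq_fintype_card, Fintype.card_subtype, Set.mem_univ,
    implies_true, true_and, Nat.cast_inj]

theorem halfAscU_eq (n k : ℕ) :
    halfAscU n k = Nat.card {p : Equiv.Perm (Fin n) //
      (∀ i ∈ descents p, i.val ∈ {m : ℕ | Odd m}) ∧ ((descents p).card : ℤ) = k} := by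
  classical
  simp only [halfAscU, Nat.card_eq_fintype_card, Fintype.card_subtype, ← halfAscending_iff,
    Nat.cast_inj]

theorem theorem2 (n k : ℕ) (hn : 1 ≤ n) (hk : 1 ≤ k) (hkn : k ≤ n) :
    eulerianA n (k - 1) * eulerianA n (k + 1) ≤ eulerianA n k ^ 2 ∧
      halfAscU n (k - 1) * halfAscU n (k + 1) ≤ halfAscU n k ^ 2 := by
  obtain ⟨m, rfl⟩ : ∃ m, n = m + 1 := ⟨n - 1, by omega⟩
  simp only [eulerianA_eq, halfAscU_eq, Nat.cast_sub hk, Nat.cast_add, Nat.cast_one]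
  exact ⟨card_descents_in_logConcave _ m k, card_descents_in_logConcave _ m k⟩
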